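/- All graphs are finite and simple. For a tree $T$, a \emph{$T$-graph} is the intersection graph of connected subgraphs of a subdivision of $T$. \textbf{Notions.} Let $G$ be a graph. A vertex is \emph{simplicial} if its neighbourhood is a clique. The \emph{weighted clique graph} of $G$ has the maximal cliques of $G$ as nodes, two distinct ones being adjacent if they intersect, with weight the cardinality of the intersection; a \emph{clique tree} is a maximum-weight spanning tree of it (a spanning forest with one tree per component, if it is disconnected), and a \emph{leaf clique} is a maximal clique that has at most one neighbour in some clique tree. A set $S$ \emph{separates} $A$ from $B$ if no path of $G-S$ leads from $A\setminus S$ to $B\setminus S$. For members $A,B$ of a family $\mathcal K$ of cliques, $A\preceq B$ means that some $K\in\mathcal K\setminus\{A,B\}$ is separated by $B$ from $A$; we say that $K$ witnesses $A\preceq B$. $A\precneqq B$ means $A\preceq B$ and $B\not\preceq A$; and $A\approx B$ means that $A\preceq B$ and $B\preceq A$ are witnessed by the same $K$. For a vertex set $F$ with neighbourhood $Z=N(F)$, the \emph{completion} $F^+$ consists of $G[F\cup Z]$, a new vertex $l$ (which stands for the contracted rest of $G$) with neighbourhood $Z$, and a further new vertex $l'$ (the tail) adjacent only to $l$. \textbf{The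 extraction procedure} on input $G$: \begin{enumerate} \item Let $\mathcal L$ be the set of all leaf cliques of $G$. \item Let $\mathcal L_0$ be the set of those $L_2\in\mathcal L$ for which no $L_1\in\mathcal L$ satisfies $L_1\precneqq L_2$ (in the family $\mathcal L$). \item Let $\mathcal L_1$ be the set of those $L\in\mathcal L_0$ with $L\not\approx L'$ (in the family $\mathcal L_0$) for all $L'\in\mathcal L_0\setminus\{L\}$. If $\mathcal L_1\neq\emptyset$, output the sets $\{x\in L: x\text{ simplicial in }G\}$, $L\in\mathcal L_1$. \item Otherwise, call $Z\subseteq L_1\cap L_2$ a joint separator for $L_1,L_2$ if $Z$ separates $L_1\mathbin{\Delta}L_2$ from some $L\in\mathcal L_0\setminus\{L_1,L_2\}$. Let $\mathcal Z$ be the family of the inclusion-minimal sets that are a joint separator for some pair of distinct $L_1\approx L_2$ in $\mathcal L_0$. \item Let $\mathcal C$ be the set of connected components of $G-\bigcup\mathcal Z$, and let $\mathcal C_0$ consist of those $F\in\mathcal C$ that are incident to just one separator $Z_F\in\mathcal Z$, meaning that $N(F)=Z_F\in\mathcal Z$. \item Obtain $\mathcal C_0'$ from $\mathcal C_0$ by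 joining, for each $Z$, all those $F\in\mathcal C_0$ with $Z_F=Z$ all of whose vertices are adjacent to every vertex of $Z$ into one graph. Let $\mathcal C_1$ be the set of those $F\in\mathcal C_0'$ for which $F^+$ is an interval graph. \item If $\mathcal C_1\neq\emptyset$, output $\mathcal C_1$. \item Otherwise, call the procedure recursively on $F^+$ for each $F\in\mathcal C_0'$, and output all fragments returned by these calls that are contained in the respective $F$. \end{enumerate} The members of the output are vertex sets, identified with the subgraphs that they induce. \textbf{Lemma.} Let $T$ be a tree and let $G$ and $G'$ be isomorphic $T$-graphs. If the procedure computes the collection $X_1,\dots,X_s$ for $G$ and the collection $X_1',\dots,X_{s'}'$ for $G'$, then $s=s'$, and there is an isomorphism $G\to G'$ which maps $X_1,\dots,X_s$, in some order, onto $X_1',\dots,X_s'$. -/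

import Mathlib

universe u v w

namespace TGraph

/-! ### Intersection graphs of subtrees -/

/-- `S` is a subdivision of `T`: the nodes of `T` are kept, every edge of `T` is replaced by a
path between its ends, these paths meet only in common ends, and nothing else is in `S`. -/
def IsSubdivision {W : Type w} {W' : Type v} (T : SimpleGraph W) (S : SimpleGraph W') : Prop :=
  ∃ (node : W → W') (path : ∀ a b : W, T.Adj a b → S.Walk (node a) (node b)),
    Function.Injective node ∧
    (∀ a b (h : T.Adj a b), (path a b h).IsPath) ∧
    (∀ a b (h : T.Adj a b), path b a h.symm = (path a b h).reverse) ∧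
    (∀ a b (h : T.Adj a b) (c : W), node c ∈ (path a b h).support → c = a ∨ c = b) ∧
    (∀ a b (h : T.Adj a b) c d (h' : T.Adj c d), s(a, b) ≠ s(c, d) →
      ∀ x, x ∈ (path a b h).support → x ∈ (path c d h').support → ∃ e, x = node e) ∧
    (∀ x : W', (∃ a, x = node a) ∨ ∃ a b, ∃ h : T.Adj a b, x ∈ (path a b h).support) ∧
    (∀ e ∈ S.edgeSet, ∃ a b, ∃ h : T.Adj a b, e ∈ (path a b h).edges)

/-- `G` is a `T`-graph: the intersection graph of connected subgraphs of a (finite) subdivision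
of `T`. -/
def IsTGraph {W : Type w} {V : Type u} (T : SimpleGraph W) (G : SimpleGraph V) : Prop :=
  ∃ (n : ℕ) (S : SimpleGraph (Fin n)), IsSubdivision T S ∧
    ∃ M : V → S.Subgraph, (∀ x, (M x).Connected) ∧
      ∀ x y, x ≠ y → (G.Adj x y ↔ ((M x).verts ∩ (M y).verts).Nonempty)

/-- `G` is an interval graph: the intersection graph of closed intervals of the real line. -/
def IsInterval {V : Type u} (G : SimpleGraph V) : Prop :=
  ∃ l r : V → ℝ, (∀ x, l x ≤ r x) ∧
    ∀ x y, x ≠ y → (G.Adj x y ↔ (Set.Icc (l x) (r x) ∩ Set.Icc (l y) (r y)).Nonempty)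

section

variable {V : Type u} (G : SimpleGraph V)

/-! ### Clique trees and leaf cliques -/

/-- A vertex is simplicial if its neighbourhood is a clique. -/
def IsSimplicial (x : V) : Prop := G.IsClique (G.neighborSet x)

/-- The maximal cliques of `G`. -/
abbrev MaxClique : Type u := {C : Set V // Maximal G.IsClique C}

/-- The clique graph: two distinct maximal cliques are adjacent if they intersect. -/
def cliqueGraph : SimpleGraph (MaxClique G) where
  Adj C D := C ≠ D ∧ (C.1 ∩ D.1).Nonempty
  symm := ⟨fun C D h => ⟨h.1.symm, by rw [Set.inter_comm]; exact h.2⟩⟩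
  loopless := ⟨fun _ h => h.1 rfl⟩

/-- The weight of an edge of the clique graph is the cardinality of the intersection. -/
noncomputable def edgeWeight : Sym2 (MaxClique G) → ℕ :=
  Sym2.lift ⟨fun C D => (C.1 ∩ D.1).ncard, fun C D => by simp only [Set.inter_comm]⟩

/-- The total weight of a graph on the maximal cliques. -/
noncomputable def weight (H : SimpleGraph (MaxClique G)) : ℕ :=
  ∑ᶠ e ∈ H.edgeSet, edgeWeight G e

/-- `H` is a spanning tree of `K` (a spanning forest with one tree for every component, if `K` is
disconnected). -/
def IsSpanningTree {U : Type u} (K H : SimpleGraph U) : Prop :=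
  H ≤ K ∧ H.IsAcyclic ∧ ∀ a b, K.Reachable a b → H.Reachable a b

/-- Clique trees are the maximum-weight spanning trees of the weighted clique graph. -/
def IsCliqueTree (H : SimpleGraph (MaxClique G)) : Prop :=
  IsSpanningTree (cliqueGraph G) H ∧
    ∀ H', IsSpanningTree (cliqueGraph G) H' → weight G H' ≤ weight G H

/-- The family `𝓛` of leaf cliques: maximal cliques that are a leaf (a node with at most one
neighbour; the only node of a one-node tree counts) of some clique tree. -/
def leafCliques : Set (Set V) :=
  {L | ∃ C : MaxClique G, C.1 = L ∧ ∃ H, IsCliqueTree G H ∧ (H.neighborSet C).Subsingleton}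

/-! ### Separation and the comparison of cliques -/

/-- `S` separates `A` from `B` in `G`: no path of `G - S` leads from `A \ S` to `B \ S`. -/
def Separates (S A B : Set V) : Prop :=
  ∀ a ∈ A \ S, ∀ b ∈ B \ S, ∀ p : G.Walk a b, ∃ x ∈ p.support, x ∈ S

/-- `A ⪯ B` in the collection `𝓚`: `B` separates `A` from a third member of `𝓚`. -/
def Prec (𝓚 : Set (Set V)) (A B : Set V) : Prop :=
  ∃ K ∈ 𝓚, K ≠ A ∧ K ≠ B ∧ Separates G B A K

/-- `A ⋨ B`: `A ⪯ B` but not `B ⪯ A`. -/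
def StrictPrec (𝓚 : Set (Set V)) (A B : Set V) : Prop :=
  Prec G 𝓚 A B ∧ ¬ Prec G 𝓚 B A

/-- `A ≈ B`: both `A ⪯ B` and `B ⪯ A` hold and are witnessed by the same third member. -/
def Approx (𝓚 : Set (Set V)) (A B : Set V) : Prop :=
  ∃ K ∈ 𝓚, K ≠ A ∧ K ≠ B ∧ Separates G B A K ∧ Separates G A B K

/-- `𝓛₀`: the leaf cliques `L₂` for which there is no leaf clique `L₁ ⋨ L₂`. -/
def leafCliques₀ : Set (Set V) :=
  {L ∈ leafCliques G | ∀ L' ∈ leafCliques G, ¬ StrictPrec G (leafCliques G) L' L}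

/-- `𝓛₁`: the members of `𝓛₀` incomparable by `≈` (within `𝓛₀`) with all other members. -/
def leafCliques₁ : Set (Set V) :=
  {L ∈ leafCliques₀ G | ∀ L' ∈ leafCliques₀ G, L' ≠ L → ¬ Approx G (leafCliques₀ G) L L'}

/-- The fragments output if `𝓛₁` is nonempty: for every `L ∈ 𝓛₁` the simplicial vertices in `L`. -/
def simplicialFragments : Set (Set V) :=
  {F | ∃ L ∈ leafCliques₁ G, F = {x ∈ L | IsSimplicial G x}}

/-! ### Joint separators and the parts they cut off -/

/-- `Z` is a joint separator for `L₁`, `L₂`. -/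
def IsJointSeparator (L₁ L₂ Z : Set V) : Prop :=
  Z ⊆ L₁ ∩ L₂ ∧
    ∃ L ∈ leafCliques₀ G, L ≠ L₁ ∧ L ≠ L₂ ∧ Separates G Z (symmDiff L₁ L₂) L

/-- The family `𝓩` of the inclusion-minimal sets that are a joint separator for some pair of
distinct `L₁ ≈ L₂` in `𝓛₀`. -/
def separators : Set (Set V) :=
  {Z | Minimal (fun Z => ∃ L₁ ∈ leafCliques₀ G, ∃ L₂ ∈ leafCliques₀ G,
    L₁ ≠ L₂ ∧ Approx G (leafCliques₀ G) L₁ L₂ ∧ IsJointSeparator G L₁ L₂ Z) Z}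

/-- `𝓒`: the (vertex sets of) connected components of `G - ⋃ 𝓩`. -/
def components : Set (Set V) :=
  {F | ∃ c : (G.induce (⋃₀ separators G)ᶜ).ConnectedComponent, F = Subtype.val '' c.supp}

/-- The neighbourhood of a vertex set (outside of it). -/
def nbr (F : Set V) : Set V := {z | z ∉ F ∧ ∃ x ∈ F, G.Adj x z}

/-- `𝓒₀`: the components incident to just one separator `Z_F ∈ 𝓩`, that is, the components of
`G - ⋃ 𝓩` whose neighbourhood is one member of `𝓩`; it is `Z_F = nbr G F`. Since members of `𝓩`
are not contained in each other, `Z_F` is the only member of `𝓩` inside this neighbourhood. -/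
def components₀ : Set (Set V) :=
  {F ∈ components G | nbr G F ∈ separators G}

/-- Every vertex of `F` is adjacent to the whole separator of `F`. -/
def IsFull (F : Set V) : Prop := ∀ x ∈ F, ∀ z ∈ nbr G F, G.Adj x z

/-- `𝓒₀'`: for every `Z`, the full `F ∈ 𝓒₀` with `Z_F = Z` (if any) are joined into one graph; the
other members of `𝓒₀` are kept. -/
def components₀' : Set (Set V) :=
  {F ∈ components₀ G | ¬ IsFull G F} ∪
  {F | ∃ F' ∈ components₀ G, IsFull G F' ∧
    F = ⋃₀ {F'' ∈ components₀ G | nbr G F'' = nbr G F' ∧ IsFull G F''}}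

/-- Vertices of a completion: the old vertices in `U`, the contracted vertex `hub`, the `tail`. -/
inductive ComplVert {V : Type u} (U : Set V) : Type u
  | old (x : U) : ComplVert U
  | hub : ComplVert U
  | tail : ComplVert U

/-- The completion `F⁺`: the subgraph induced on `F` and its separator `Z = nbr G F`, a vertex `hub`
(all other vertices, contracted) with neighbourhood `Z`, and a `tail` attached to `hub`. -/
def completion (F : Set V) : SimpleGraph (ComplVert (F ∪ nbr G F)) where
  Adj
    | .old x, .old y => G.Adj x y
    | .old x, .hub => x.1 ∈ nbr G F
    | .hub, .old x => x.1 ∈ nbr G F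
    | .hub, .tail => True
    | .tail, .hub => True
    | _, _ => False
  symm := ⟨by
    rintro (x | _ | _) (y | _ | _) h
    all_goals first | exact h | exact SimpleGraph.Adj.symm h⟩
  loopless := ⟨by
    rintro (x | _ | _) h
    all_goals first | exact h | exact G.irrefl h⟩

/-- `𝓒₁`: the members of `𝓒₀'` whose completion is an interval graph. -/
def components₁ : Set (Set V) :=
  {F ∈ components₀' G | IsInterval (completion G F)}

/-- A set of vertices of `F`, viewed in the completion of `F`. -/
def lift (F X : Set V) : Set (ComplVert (F ∪ nbr G F)) :=
  {y | ∃ (x : V) (h : x ∈ F ∪ nbr G F), x ∈ X ∧ y = .old ⟨x, h⟩}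

end

/-- `Computes V G 𝒳`: the extraction procedure, run on the graph `G` with vertex set `V`,
terminates and outputs the fragment collection `𝒳` (fragments are induced subgraphs, given by
their vertex sets). In the recursive case `out F` is the output of the recursive call on the
completion of `F`, and the fragments that lie in `F` are kept. -/
inductive Computes : (V : Type u) → SimpleGraph V → Set (Set V) → Prop
  | simplicial (V : Type u) (G : SimpleGraph V) (h₁ : (leafCliques₁ G).Nonempty) :
      Computes V G (simplicialFragments G)
  | interval (V : Type u) (G : SimpleGraph V) (h₁ : ¬ (leafCliques₁ G).Nonempty)
      (h₂ : (components₁ G).Nonempty) :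
      Computes V G (components₁ G)
  | recursive (V : Type u) (G : SimpleGraph V) (h₁ : ¬ (leafCliques₁ G).Nonempty)
      (h₂ : ¬ (components₁ G).Nonempty)
      (out : ∀ F : Set V, Set (Set (ComplVert (F ∪ nbr G F))))
      (h₃ : ∀ F ∈ components₀' G,
        Computes (ComplVert (F ∪ nbr G F)) (completion G F) (out F)) :
      Computes V G {X | ∃ F ∈ components₀' G, X ⊆ F ∧ lift G F X ∈ out F}

end TGraph

namespace TGraph

section Transport

variable {V : Type u} {V' : Type v} {G : SimpleGraph V} {G' : SimpleGraph V'}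

/-! Every object in the procedure is defined from adjacency alone, and no step makes an arbitrary
choice. So each isomorphism `φ : G ≃g G'` carries the output for `G` onto the output for `G'`, not
just some suitable one.

Taking images under `φ` is an inclusion-preserving bijection on vertex sets. Invariance of a family
therefore takes the form `φ '' A ∈ 𝓚' ↔ A ∈ 𝓚`, proved in turn for leaf cliques, separators,
components and fragments. For the recursion, `completionIso` extends `φ` to the completions, and
`Computes.image_eq` is an induction on the run of the procedure. -/

theorem image_surjective (φ : G ≃g G') : Function.Surjective (fun A : Set V => φ '' A) :=
  Set.image_surjective.2 φ.surjective

theorem image_injective (φ : G ≃g G') : Function.Injective (fun A : Set V => φ '' A) :=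
  Set.image_injective.2 φ.injective

theorem symm_image_image (φ : G ≃g G') (A : Set V) : φ.symm '' (φ '' A) = A := by
  ext x
  simp [Set.mem_image]

theorem image_inj (φ : G ≃g G') {A B : Set V} : φ '' A = φ '' B ↔ A = B :=
  (image_injective φ).eq_iff

theorem mem_image_iff (φ : G ≃g G') {A : Set V} {x : V} : φ x ∈ φ '' A ↔ x ∈ A :=
  φ.injective.mem_set_image

/-- As rewrite rules, this and `exists_set` make every set quantified over in `G'` an image, so that
the invariance lemmas apply under the quantifier. -/
theorem forall_set (φ : G ≃g G') {p : Set V' → Prop} : (∀ A, p A) ↔ ∀ A : Set V, p (φ '' A) :=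
  (image_surjective φ).forall

theorem exists_set (φ : G ≃g G') {p : Set V' → Prop} : (∃ A, p A) ↔ ∃ A : Set V, p (φ '' A) :=
  (image_surjective φ).exists

theorem image_family_eq (φ : G ≃g G') {𝓚 : Set (Set V)} {𝓚' : Set (Set V')}
    (h : ∀ A, φ '' A ∈ 𝓚' ↔ A ∈ 𝓚) : (fun A : Set V => φ '' A) '' 𝓚 = 𝓚' := by
  ext A'
  obtain ⟨A, rfl⟩ := image_surjective φ A'
  exact (image_injective φ).mem_set_image.trans (h A).symm

/-! ### Cliques and simplicial vertices -/

theorem isClique_image (φ : G ≃g G') (A : Set V) : G'.IsClique (φ '' A) ↔ G.IsClique A := by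
  simp only [SimpleGraph.isClique_iff, Set.Pairwise, Set.forall_mem_image, φ.map_adj_iff,
    φ.injective.ne_iff]

theorem maximal_image (φ : G ≃g G') {p : Set V → Prop} {p' : Set V' → Prop}
    (h : ∀ A, p' (φ '' A) ↔ p A) (A : Set V) : Maximal p' (φ '' A) ↔ Maximal p A := by
  simp only [Maximal, forall_set φ, h, Set.image_subset_image_iff φ.injective]

theorem minimal_image (φ : G ≃g G') {p : Set V → Prop} {p' : Set V' → Prop}
    (h : ∀ A, p' (φ '' A) ↔ p A) (A : Set V) : Minimal p' (φ '' A) ↔ Minimal p A := by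
  simp only [Minimal, forall_set φ, h, Set.image_subset_image_iff φ.injective]

theorem image_neighborSet (φ : G ≃g G') (x : V) : φ '' G.neighborSet x = G'.neighborSet (φ x) := by
  ext y
  obtain ⟨y, rfl⟩ := φ.surjective y
  rw [mem_image_iff]
  exact φ.map_adj_iff.symm

theorem isSimplicial_apply (φ : G ≃g G') (x : V) : IsSimplicial G' (φ x) ↔ IsSimplicial G x := by
  unfold IsSimplicial
  rw [← image_neighborSet, isClique_image]

/-! ### Clique trees and leaf cliques -/

/-- The bijection between the maximal cliques of isomorphic graphs, as an isomorphism of the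
clique graphs. -/
def cliqueGraphIso (φ : G ≃g G') : cliqueGraph G ≃g cliqueGraph G' where
  toFun C := ⟨φ '' C.1, (maximal_image φ (isClique_image φ) C.1).2 C.2⟩
  invFun C := ⟨φ.symm '' C.1, (maximal_image φ.symm (isClique_image φ.symm) C.1).2 C.2⟩
  left_inv C := Subtype.ext (symm_image_image φ C.1)
  right_inv C := Subtype.ext (symm_image_image φ.symm C.1)
  map_rel_iff' {C D} := by
    simp [cliqueGraph, Subtype.ext_iff, ← Set.image_inter φ.injective, image_inj]

theorem cliqueGraphIso_val (φ : G ≃g G') (C : MaxClique G) : (cliqueGraphIso φ C).1 = φ '' C.1 :=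
  rfl

theorem edgeWeight_map (φ : G ≃g G') (e : Sym2 (MaxClique G)) :
    edgeWeight G' (e.map (cliqueGraphIso φ)) = edgeWeight G e := by
  induction e with
  | _ C D =>
    simp only [Sym2.map_mk, edgeWeight, Sym2.lift_mk, cliqueGraphIso_val,
      ← Set.image_inter φ.injective]
    exact Set.ncard_image_of_injective _ φ.injective

/-- The clique bijection matches the edges and keeps their weights, so the sum is only reindexed.
Relating `H` and `H'` by a hypothesis allows either one to be the pullback of the other. -/
theorem weight_eq (φ : G ≃g G') {H : SimpleGraph (MaxClique G)} {H' : SimpleGraph (MaxClique G')}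
    (h : ∀ C D, H'.Adj (cliqueGraphIso φ C) (cliqueGraphIso φ D) ↔ H.Adj C D) :
    weight G' H' = weight G H := by
  have hE : H'.edgeSet = Sym2.map (cliqueGraphIso φ) '' H.edgeSet := by
    ext e
    obtain ⟨e, rfl⟩ : ∃ e₀, Sym2.map (cliqueGraphIso φ) e₀ = e := by
      induction e with
      | _ C D =>
        obtain ⟨C, rfl⟩ := (cliqueGraphIso φ).surjective C
        obtain ⟨D, rfl⟩ := (cliqueGraphIso φ).surjective D
        exact ⟨s(C, D), rfl⟩
    rw [(Sym2.map.injective (cliqueGraphIso φ).injective).mem_set_image]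
    induction e with
    | _ C D => simpa using h C D
  unfold weight
  rw [hE, finsum_mem_image (Sym2.map.injective (cliqueGraphIso φ).injective).injOn]
  simp only [edgeWeight_map]

theorem IsSpanningTree.comap {U : Type u} {U' : Type v} {K : SimpleGraph U} {K' : SimpleGraph U'}
    (e : K ≃g K') {H : SimpleGraph U'} (h : IsSpanningTree K' H) :
    IsSpanningTree K (H.comap e) := by
  -- The pullback along a bijection is isomorphic to `H`, so acyclicity and reachability carry over.
  let f : H.comap e ≃g H := ⟨e.toEquiv, Iff.rfl⟩
  refine ⟨fun a b hab => e.map_adj_iff.1 (h.1 hab), f.isAcyclic_iff.2 h.2.1, fun a b hab => ?_⟩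
  exact f.reachable_iff.1 (h.2.2 _ _ (e.reachable_iff.2 hab))

theorem IsCliqueTree.comap (φ : G ≃g G') {H : SimpleGraph (MaxClique G')}
    (h : IsCliqueTree G' H) : IsCliqueTree G (H.comap (cliqueGraphIso φ)) := by
  refine ⟨h.1.comap _, fun H₁ h₁ => ?_⟩
  -- A competitor in `G` is moved to `G'`, where `H` is optimal; both moves preserve weight.
  have h₂ := h.2 _ (h₁.comap (cliqueGraphIso φ).symm)
  rwa [← weight_eq φ (H := H.comap (cliqueGraphIso φ)) (H' := H) fun _ _ => Iff.rfl,
    ← weight_eq φ (H := H₁) (H' := H₁.comap (cliqueGraphIso φ).symm) fun C D => by simp]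

/-- One direction suffices for the equivalence: the other is this one for `φ.symm`. The same device
serves separation, components and interval graphs. -/
theorem mem_leafCliques_of_image (φ : G ≃g G') {A : Set V} (h : φ '' A ∈ leafCliques G') :
    A ∈ leafCliques G := by
  obtain ⟨C, hC, H, hH, hs⟩ := h
  obtain ⟨C, rfl⟩ := (cliqueGraphIso φ).surjective C
  refine ⟨C, (image_inj φ).1 hC, _, hH.comap φ, fun D hD E hE => ?_⟩
  exact (cliqueGraphIso φ).injective (hs hD hE)

theorem image_mem_leafCliques (φ : G ≃g G') (A : Set V) :
    φ '' A ∈ leafCliques G' ↔ A ∈ leafCliques G :=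
  ⟨mem_leafCliques_of_image φ, fun h => mem_leafCliques_of_image φ.symm
    (by rwa [symm_image_image])⟩

/-! ### Separation and comparison of leaf cliques -/

theorem Separates.of_image (φ : G ≃g G') {S A B : Set V}
    (h : Separates G' (φ '' S) (φ '' A) (φ '' B)) : Separates G S A B := by
  intro a ha b hb p
  obtain ⟨x, hx, hxS⟩ := h (φ a) ⟨⟨a, ha.1, rfl⟩, fun h => ha.2 ((mem_image_iff φ).1 h)⟩
    (φ b) ⟨⟨b, hb.1, rfl⟩, fun h => hb.2 ((mem_image_iff φ).1 h)⟩ (p.map φ.toHom)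
  rw [SimpleGraph.Walk.support_map, List.mem_map] at hx
  obtain ⟨y, hy, rfl⟩ := hx
  exact ⟨y, hy, (mem_image_iff φ).1 hxS⟩

theorem separates_image (φ : G ≃g G') (S A B : Set V) :
    Separates G' (φ '' S) (φ '' A) (φ '' B) ↔ Separates G S A B :=
  ⟨Separates.of_image φ, fun h => Separates.of_image φ.symm (by simpa only [symm_image_image])⟩

/-- The family is a parameter here and in `approx_image`, since `⪯` is evaluated in `𝓛` and `≈` in
`𝓛₀`. -/
theorem prec_image (φ : G ≃g G') {𝓚 : Set (Set V)} {𝓚' : Set (Set V')}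
    (h : ∀ A, φ '' A ∈ 𝓚' ↔ A ∈ 𝓚) (A B : Set V) :
    Prec G' 𝓚' (φ '' A) (φ '' B) ↔ Prec G 𝓚 A B := by
  simp only [Prec, exists_set φ, h, ne_eq, image_inj, separates_image]

theorem approx_image (φ : G ≃g G') {𝓚 : Set (Set V)} {𝓚' : Set (Set V')}
    (h : ∀ A, φ '' A ∈ 𝓚' ↔ A ∈ 𝓚) (A B : Set V) :
    Approx G' 𝓚' (φ '' A) (φ '' B) ↔ Approx G 𝓚 A B := by
  simp only [Approx, exists_set φ, h, ne_eq, image_inj, separates_image]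

theorem image_mem_leafCliques₀ (φ : G ≃g G') (A : Set V) :
    φ '' A ∈ leafCliques₀ G' ↔ A ∈ leafCliques₀ G := by
  simp only [leafCliques₀, StrictPrec, Set.mem_ofPred_eq, forall_set φ, image_mem_leafCliques,
    prec_image φ (image_mem_leafCliques φ)]

theorem image_mem_leafCliques₁ (φ : G ≃g G') (A : Set V) :
    φ '' A ∈ leafCliques₁ G' ↔ A ∈ leafCliques₁ G := by
  simp only [leafCliques₁, Set.mem_ofPred_eq, forall_set φ, image_mem_leafCliques₀,
    approx_image φ (image_mem_leafCliques₀ φ), ne_eq, image_inj]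

theorem nonempty_iff_of_image (φ : G ≃g G') {𝓚 : Set (Set V)} {𝓚' : Set (Set V')}
    (h : ∀ A, φ '' A ∈ 𝓚' ↔ A ∈ 𝓚) : 𝓚'.Nonempty ↔ 𝓚.Nonempty := by
  simp only [Set.Nonempty, exists_set φ, h]

theorem image_mem_simplicialFragments (φ : G ≃g G') (A : Set V) :
    φ '' A ∈ simplicialFragments G' ↔ A ∈ simplicialFragments G := by
  have key (L : Set V) :
      {x ∈ φ '' L | IsSimplicial G' x} = φ '' {x ∈ L | IsSimplicial G x} := by
    ext x
    obtain ⟨x, rfl⟩ := φ.surjective x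
    rw [mem_image_iff]
    simp only [Set.mem_ofPred_eq, mem_image_iff, isSimplicial_apply]
  simp only [simplicialFragments, Set.mem_ofPred_eq, exists_set φ, image_mem_leafCliques₁, key,
    image_inj]

/-! ### Separators and components -/

theorem isJointSeparator_image (φ : G ≃g G') (L₁ L₂ Z : Set V) :
    IsJointSeparator G' (φ '' L₁) (φ '' L₂) (φ '' Z) ↔ IsJointSeparator G L₁ L₂ Z := by
  simp only [IsJointSeparator, exists_set φ, image_mem_leafCliques₀, ne_eq, image_inj,
    ← Set.image_inter φ.injective, ← Set.image_symmDiff φ.injective, separates_image,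
    Set.image_subset_image_iff φ.injective]

theorem image_mem_separators (φ : G ≃g G') (Z : Set V) :
    φ '' Z ∈ separators G' ↔ Z ∈ separators G := by
  unfold separators
  rw [Set.mem_ofPred_eq, Set.mem_ofPred_eq]
  refine minimal_image φ (fun Z => ?_) Z
  simp only [exists_set φ, image_mem_leafCliques₀, ne_eq, image_inj, isJointSeparator_image,
    approx_image φ (image_mem_leafCliques₀ φ)]

theorem sUnion_eq_image (φ : G ≃g G') {𝓚 : Set (Set V)} {𝓚' : Set (Set V')}
    (h : ∀ A, φ '' A ∈ 𝓚' ↔ A ∈ 𝓚) : ⋃₀ 𝓚' = φ '' ⋃₀ 𝓚 := by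
  ext x
  obtain ⟨x, rfl⟩ := φ.surjective x
  simp only [Set.mem_sUnion, mem_image_iff, exists_set φ, h]

theorem mem_components_of_image (φ : G ≃g G') {F : Set V} (h : φ '' F ∈ components G') :
    F ∈ components G := by
  have hx (x : V) : x ∈ (⋃₀ separators G)ᶜ ↔ φ x ∈ (⋃₀ separators G')ᶜ := by
    rw [Set.mem_compl_iff, Set.mem_compl_iff, sUnion_eq_image φ (image_mem_separators φ),
      mem_image_iff]
  -- As `φ` maps `⋃ 𝓩` onto its counterpart, it restricts to the graphs left after deletion and thus
  -- preserves reachability there.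
  let ψ : G.induce (⋃₀ separators G)ᶜ ≃g G'.induce (⋃₀ separators G')ᶜ :=
    ⟨φ.toEquiv.subtypeEquiv hx, φ.map_adj_iff⟩
  obtain ⟨c, hc⟩ := h
  obtain ⟨⟨a, ha⟩, rfl⟩ := c.exists_rep
  obtain ⟨⟨a, ha⟩, h⟩ := ψ.surjective ⟨a, ha⟩
  rw [← h] at hc
  refine ⟨(G.induce _).connectedComponentMk ⟨a, ha⟩, ?_⟩
  ext x
  rw [← mem_image_iff φ, hc]
  constructor
  · rintro ⟨y, hy, hyx⟩
    obtain ⟨y, rfl⟩ := ψ.surjective y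
    refine ⟨y, ?_, φ.injective hyx⟩
    have hy : (G'.induce _).Reachable (ψ y) (ψ ⟨a, ha⟩) :=
      SimpleGraph.ConnectedComponent.eq.1 hy
    exact SimpleGraph.ConnectedComponent.eq.2 (ψ.reachable_iff.1 hy)
  · rintro ⟨y, hy, rfl⟩
    have hy : (G.induce _).Reachable y ⟨a, ha⟩ := SimpleGraph.ConnectedComponent.eq.1 hy
    exact ⟨ψ y, SimpleGraph.ConnectedComponent.eq.2 (ψ.reachable_iff.2 hy), rfl⟩

theorem image_mem_components (φ : G ≃g G') (F : Set V) :
    φ '' F ∈ components G' ↔ F ∈ components G :=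
  ⟨mem_components_of_image φ, fun h => mem_components_of_image φ.symm (by rwa [symm_image_image])⟩

theorem nbr_image (φ : G ≃g G') (F : Set V) : nbr G' (φ '' F) = φ '' nbr G F := by
  ext z
  obtain ⟨z, rfl⟩ := φ.surjective z
  simp only [nbr, mem_image_iff, Set.mem_ofPred_eq, Set.exists_mem_image, φ.map_adj_iff]

theorem image_mem_components₀ (φ : G ≃g G') (F : Set V) :
    φ '' F ∈ components₀ G' ↔ F ∈ components₀ G := by
  simp only [components₀, Set.mem_ofPred_eq, image_mem_components, nbr_image, image_mem_separators]

theorem isFull_image (φ : G ≃g G') (F : Set V) : IsFull G' (φ '' F) ↔ IsFull G F := by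
  simp only [IsFull, nbr_image, Set.forall_mem_image, φ.map_adj_iff]

theorem image_mem_components₀' (φ : G ≃g G') (F : Set V) :
    φ '' F ∈ components₀' G' ↔ F ∈ components₀' G := by
  -- The members joined for one separator correspond under `φ`, hence so do their unions.
  have key (F' : Set V) :
      ⋃₀ {F'' ∈ components₀ G' | nbr G' F'' = φ '' nbr G F' ∧ IsFull G' F''} =
        φ '' ⋃₀ {F'' ∈ components₀ G | nbr G F'' = nbr G F' ∧ IsFull G F''} :=
    sUnion_eq_image φ fun A => by
      simp only [Set.mem_ofPred_eq, image_mem_components₀, nbr_image, image_inj, isFull_image]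
  simp only [components₀', Set.mem_union, Set.mem_ofPred_eq, exists_set φ, image_mem_components₀,
    isFull_image, nbr_image, key, image_inj]

/-! ### Completions and interval graphs -/

theorem mem_union_nbr_iff (φ : G ≃g G') (F : Set V) (x : V) :
    x ∈ F ∪ nbr G F ↔ φ x ∈ φ '' F ∪ nbr G' (φ '' F) := by
  rw [nbr_image, ← Set.image_union, mem_image_iff]

/-- A bijection between sets, extended by the two new vertices of a completion. -/
def ComplVert.congr {U : Set V} {U' : Set V'} (e : U ≃ U') : ComplVert U ≃ ComplVert U' where
  toFun
    | .old x => .old (e x)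
    | .hub => .hub
    | .tail => .tail
  invFun
    | .old x => .old (e.symm x)
    | .hub => .hub
    | .tail => .tail
  left_inv := by rintro (x | _ | _) <;> simp
  right_inv := by rintro (x | _ | _) <;> simp

/-- An isomorphism extends to the completions of corresponding vertex sets. -/
def completionIso (φ : G ≃g G') (F : Set V) : completion G F ≃g completion G' (φ '' F) where
  toEquiv := ComplVert.congr (φ.toEquiv.subtypeEquiv (mem_union_nbr_iff φ F))
  map_rel_iff' {a b} := by
    -- Apart from pairs of old vertices, only adjacency between an old vertex and the hub depends on
    -- the graph.
    have hn (x : V) : φ x ∈ nbr G' (φ '' F) ↔ x ∈ nbr G F := by rw [nbr_image, mem_image_iff]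
    rcases a with x | _ | _ <;> rcases b with y | _ | _
    · exact φ.map_adj_iff
    · exact hn x.1
    · exact Iff.rfl
    · exact hn y.1
    all_goals exact Iff.rfl

theorem lift_image (φ : G ≃g G') (F X : Set V) :
    lift G' (φ '' F) (φ '' X) = completionIso φ F '' lift G F X := by
  ext y
  constructor
  · rintro ⟨_, h, ⟨x, hx, rfl⟩, rfl⟩
    exact ⟨_, ⟨x, (mem_union_nbr_iff φ F x).2 h, hx, rfl⟩, rfl⟩
  · rintro ⟨_, ⟨x, h, hx, rfl⟩, rfl⟩
    exact ⟨φ x, (mem_union_nbr_iff φ F x).1 h, ⟨x, hx, rfl⟩, rfl⟩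

theorem IsInterval.of_iso (φ : G ≃g G') (h : IsInterval G') : IsInterval G := by
  obtain ⟨l, r, hlr, h⟩ := h
  exact ⟨l ∘ φ, r ∘ φ, fun x => hlr _, fun x y hxy =>
    φ.map_adj_iff.symm.trans (h _ _ (φ.injective.ne hxy))⟩

theorem isInterval_iff (φ : G ≃g G') : IsInterval G' ↔ IsInterval G :=
  ⟨IsInterval.of_iso φ, IsInterval.of_iso φ.symm⟩

theorem image_mem_components₁ (φ : G ≃g G') (F : Set V) :
    φ '' F ∈ components₁ G' ↔ F ∈ components₁ G := by
  simp only [components₁, Set.mem_ofPred_eq, image_mem_components₀',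
    isInterval_iff (completionIso φ F)]

end Transport

/-! ### Canonicity of the output -/

/-- The extraction procedure is canonical: every isomorphism of the inputs maps the output for the
one onto the output for the other. -/
theorem Computes.image_eq {V : Type u} {G : SimpleGraph V} {𝒳 : Set (Set V)}
    (h : Computes V G 𝒳) : ∀ {V' : Type v} {G' : SimpleGraph V'} {𝒳' : Set (Set V')},
      Computes V' G' 𝒳' → ∀ φ : G ≃g G', (fun X : Set V => φ '' X) '' 𝒳 = 𝒳' := by
  -- The second graph, its output and the isomorphism stay quantified, because the recursive case
  -- needs the claim for completions and `completionIso`.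
  induction h with
  | simplicial V G h₁ =>
    intro V' G' 𝒳' h' φ
    -- Branching depends only on whether invariant families are empty, so both runs take the same
    -- branch.
    have e₁ := nonempty_iff_of_image φ (image_mem_leafCliques₁ φ)
    cases h' with
    | simplicial => exact image_family_eq φ (image_mem_simplicialFragments φ)
    | interval _ _ h₁' => exact absurd (e₁.2 h₁) h₁'
    | recursive _ _ h₁' => exact absurd (e₁.2 h₁) h₁'
  | interval V G h₁ h₂ =>
    intro V' G' 𝒳' h' φ
    have e₁ := nonempty_iff_of_image φ (image_mem_leafCliques₁ φ)
    have e₂ := nonempty_iff_of_image φ (image_mem_components₁ φ)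
    cases h' with
    | simplicial _ _ h₁' => exact absurd (e₁.1 h₁') h₁
    | interval => exact image_family_eq φ (image_mem_components₁ φ)
    | recursive _ _ _ h₂' => exact absurd (e₂.2 h₂) h₂'
  | recursive V G h₁ h₂ out h₃ ih =>
    intro V' G' 𝒳' h' φ
    have e₁ := nonempty_iff_of_image φ (image_mem_leafCliques₁ φ)
    have e₂ := nonempty_iff_of_image φ (image_mem_components₁ φ)
    cases h' with
    | simplicial _ _ h₁' => exact absurd (e₁.1 h₁') h₁
    | interval _ _ _ h₂' => exact absurd (e₂.1 h₂') h₂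
    | recursive _ _ _ _ out' h₃' =>
      refine image_family_eq φ fun X => ?_
      simp only [Set.mem_ofPred_eq, exists_set φ, image_mem_components₀',
        Set.image_subset_image_iff φ.injective, lift_image]
      refine exists_congr fun F => and_congr_right fun hF => and_congr_right fun _ => ?_
      -- `out` and `out'` come from separate runs; the induction hypothesis identifies `out' (φ ''
      -- F)` with the image of `out F`. It is available only for `F ∈ components₀' G`, hence the
      -- prior use of `hF`.
      rw [← ih F hF (h₃' _ ((image_mem_components₀' φ F).2 hF)) (completionIso φ F)]
      exact (image_injective (completionIso φ F)).mem_set_image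

end TGraph

theorem lemma2 {W : Type w} [Finite W] (T : SimpleGraph W) (hT : T.IsTree)
    {V : Type u} {V' : Type v} [Finite V] [Finite V']
    (G : SimpleGraph V) (G' : SimpleGraph V')
    (hG : TGraph.IsTGraph T G) (hG' : TGraph.IsTGraph T G')
    (hiso : Nonempty (G ≃g G'))
    (𝒳 : Set (Set V)) (𝒳' : Set (Set V'))
    (h : TGraph.Computes V G 𝒳) (h' : TGraph.Computes V' G' 𝒳') :
    𝒳.ncard = 𝒳'.ncard ∧
      ∃ φ : G ≃g G', (fun X : Set V => φ '' X) '' 𝒳 = 𝒳' := by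
  obtain ⟨φ⟩ := hiso
  have e := h.image_eq h' φ
  refine ⟨?_, φ, e⟩
  rw [← e, Set.ncard_image_of_injective _ (TGraph.image_injective φ)]
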